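/- Let $\Bbbk$ be a field and $V$ a $\Bbbk$-vector space with basis $x_1,\dots,x_n$. Let $R\subseteq V\otimes V\subseteq T(V)$ be the span of a set of quadratic monomials $x_ix_j=x_i\otimes x_j$, and let $A=T(V)/(R)$, graded by the images of the subspaces $V^{\otimes i}$. Let $\alpha:R\to V$ and $\beta:R\to\Bbbk$ be linear maps, $P=\{r-\alpha(r)-\beta(r): r\in R\}$, and $D=T(V)/(P)$, filtered by the images $\mathcal F^j(D)$ of $\bigoplus_{i\le j}V^{\otimes i}$. For $x_ix_j\in R$ define scalars $a^{ij}_m,b^{ij}\in\Bbbk$ by $\alpha(x_ix_j)=\sum_{m=1}^n a^{ij}_m x_m$ and $\beta(x_ix_j)=b^{ij}$. Call $D$ a PBW deformation of $A$ if $\mathrm{gr}_{\mathcal F}(D)=\bigoplus_{i\ge0}\mathcal F^i(D)/\mathcal F^{i-1}(D)$ (with $\mathcal F^{-1}(D)=0$) is isomorphic to $A$ as a graded $\Bbbk$-algebra. Then $D$ is a PBW deformation of $A$ if and only if, for all $i,j,k\in\{1,\dots,n\}$ with $x_ix_j\in R$ and $x_jx_k\in R$, the following hold. (I) (a) $a^{ij}_m=0$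 for every $m\ne i$ such that $x_mx_k\notin R$; (b) $a^{jk}_{m'}=0$ for every $m'\neq k$ such that $x_ix_{m'}\notin R$; (c) $a^{ij}_i=a^{jk}_k$ if $x_ix_k\notin R$. (II) For $r\in\{1,\dots,n\}$ put $$d^{ijk}_r=\sum_{m:\,x_mx_k\in R}a^{ij}_m a^{mk}_r-\sum_{m':\,x_ix_{m'}\in R}a^{im'}_r a^{jk}_{m'}.$$ (a) If $i\ne k$, then $d^{ijk}_r=0$ for all $r\neq i,k$, $d^{ijk}_k=-b^{ij}$, and $d^{ijk}_i=b^{jk}$. (b) If $i=k$, then $d^{ijk}_r=0$ for all $r\ne i$, and $d^{ijk}_i=b^{ji}-b^{ij}$. (III) $$\sum_{m:\,x_mx_k\in R}a^{ij}_m b^{mk}-\sum_{m':\,x_ix_{m'}\in R}b^{im'}a^{jk}_{m'}=0.$$ -/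

import Mathlib

/-- An increasing, exhaustive filtration of a `k`-algebra `D` by subspaces, indexed by `ℕ`. -/
structure AlgFiltration (k : Type*) (D : Type*) [Field k] [Ring D] [Algebra k D] where
  /-- The subspace `F^i(D)`. -/
  F : ℕ → Submodule k D
  mono : Monotone F
  one_mem : (1 : D) ∈ F 0
  mul_mem : ∀ {i j : ℕ} {x y : D}, x ∈ F i → y ∈ F j → x * y ∈ F (i + j)
  exhaustive : ∀ x : D, ∃ i, x ∈ F i

namespace AlgFiltration

variable {k D : Type*} [Field k] [Ring D] [Algebra k D] (𝓕 : AlgFiltration k D)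

/-- The subspace `F^{i-1}(D)`, where `F^{-1}(D) = 0`. -/
def prev : ℕ → Submodule k D
  | 0 => ⊥
  | i + 1 => 𝓕.F i

theorem prev_mul {i j : ℕ} {x y : D} (hx : x ∈ 𝓕.prev i) (hy : y ∈ 𝓕.F j) :
    x * y ∈ 𝓕.prev (i + j) := by
  cases i with
  | zero =>
    have hx0 : x = 0 := by simpa [prev] using hx
    simp [hx0]
  | succ i =>
    have h := 𝓕.mul_mem (i := i) hx hy
    rw [Nat.add_right_comm]
    exact h

theorem mul_prev {i j : ℕ} {x y : D} (hx : x ∈ 𝓕.F i) (hy : y ∈ 𝓕.prev j) :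
    x * y ∈ 𝓕.prev (i + j) := by
  cases j with
  | zero =>
    have hy0 : y = 0 := by simpa [prev] using hy
    simp [hy0]
  | succ j => exact 𝓕.mul_mem (j := j) hx hy

/-- The degree `i` part `F^i(D) / F^{i-1}(D)` of the associated graded algebra. -/
abbrev gr (i : ℕ) : Type _ := 𝓕.F i ⧸ (𝓕.prev i).comap (𝓕.F i).subtype

/-- The class `[x]` in `F^i(D) / F^{i-1}(D)` of an element `x` of `F^i(D)`. -/
def cls (i : ℕ) (x : D) (hx : x ∈ 𝓕.F i) : 𝓕.gr i := Submodule.Quotient.mk ⟨x, hx⟩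

theorem cls_eq {i : ℕ} {x y : D} {hx : x ∈ 𝓕.F i} {hy : y ∈ 𝓕.F i} :
    𝓕.cls i x hx = 𝓕.cls i y hy ↔ x - y ∈ 𝓕.prev i := by
  unfold cls
  rw [Submodule.Quotient.eq]
  rfl

theorem cls_surj {i : ℕ} (a : 𝓕.gr i) : ∃ x hx, a = 𝓕.cls i x hx := by
  obtain ⟨⟨x, hx⟩, rfl⟩ := Submodule.Quotient.mk_surjective _ a
  exact ⟨x, hx, rfl⟩

/-- The multiplication `[x] [y] = [x y]` on cosets. -/
def grMul {i j : ℕ} (a : 𝓕.gr i) (b : 𝓕.gr j) : 𝓕.gr (i + j) :=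
  Quotient.liftOn₂' a b
    (fun x y => 𝓕.cls (i + j) ((x : D) * (y : D)) (𝓕.mul_mem x.2 y.2))
    (by
      intro x y x' y' h h'
      have h1 : (x : D) - x' ∈ 𝓕.prev i := (Submodule.quotientRel_def ((𝓕.prev i).comap (𝓕.F i).subtype)).1 h
      have h2 : (y : D) - y' ∈ 𝓕.prev j := (Submodule.quotientRel_def ((𝓕.prev j).comap (𝓕.F j).subtype)).1 h'
      rw [cls_eq]
      have e : (x : D) * y - x' * y' = (x - x') * y + x' * (y - y') := by
        rw [sub_mul, mul_sub]; abel
      rw [e]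
      exact add_mem (𝓕.prev_mul h1 y.2) (𝓕.mul_prev x'.2 h2))

theorem grMul_cls {i j : ℕ} {x y : D} (hx : x ∈ 𝓕.F i) (hy : y ∈ 𝓕.F j) :
    𝓕.grMul (𝓕.cls i x hx) (𝓕.cls j y hy) = 𝓕.cls (i + j) (x * y) (𝓕.mul_mem hx hy) := rfl

theorem mk_cls_eq {i j : ℕ} (h : i = j) {x y : D} (hxy : x = y) (hx : x ∈ 𝓕.F i)
    (hy : y ∈ 𝓕.F j) :
    (GradedMonoid.mk i (𝓕.cls i x hx) : GradedMonoid 𝓕.gr) =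
      GradedMonoid.mk j (𝓕.cls j y hy) := by
  subst h hxy; rfl

instance : GradedMonoid.GMul 𝓕.gr where
  mul := 𝓕.grMul

instance : GradedMonoid.GOne 𝓕.gr where
  one := 𝓕.cls 0 1 𝓕.one_mem

instance : GradedMonoid.GMonoid 𝓕.gr where
  one_mul := by
    rintro ⟨i, a⟩
    obtain ⟨x, hx, rfl⟩ := 𝓕.cls_surj a
    exact 𝓕.mk_cls_eq (zero_add i) (one_mul x) (𝓕.mul_mem 𝓕.one_mem hx) hx
  mul_one := by
    rintro ⟨i, a⟩
    obtain ⟨x, hx, rfl⟩ := 𝓕.cls_surj a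
    exact 𝓕.mk_cls_eq (add_zero i) (mul_one x) (𝓕.mul_mem hx 𝓕.one_mem) hx
  mul_assoc := by
    rintro ⟨i, a⟩ ⟨j, b⟩ ⟨l, c⟩
    obtain ⟨x, hx, rfl⟩ := 𝓕.cls_surj a
    obtain ⟨y, hy, rfl⟩ := 𝓕.cls_surj b
    obtain ⟨z, hz, rfl⟩ := 𝓕.cls_surj c
    exact 𝓕.mk_cls_eq (add_assoc i j l) (mul_assoc x y z)
      (𝓕.mul_mem (𝓕.mul_mem hx hy) hz) (𝓕.mul_mem hx (𝓕.mul_mem hy hz))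

instance : DirectSum.GSemiring 𝓕.gr where
  mul_zero := by
    intro i j a
    obtain ⟨x, hx, rfl⟩ := 𝓕.cls_surj a
    exact 𝓕.cls_eq (hx := 𝓕.mul_mem hx (zero_mem _)) (hy := zero_mem _) |>.2 (by simp)
  zero_mul := by
    intro i j a
    obtain ⟨x, hx, rfl⟩ := 𝓕.cls_surj a
    exact 𝓕.cls_eq (hx := 𝓕.mul_mem (zero_mem _) hx) (hy := zero_mem _) |>.2 (by simp)
  mul_add := by
    intro i j a b c
    obtain ⟨x, hx, rfl⟩ := 𝓕.cls_surj a
    obtain ⟨y, hy, rfl⟩ := 𝓕.cls_surj b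
    obtain ⟨z, hz, rfl⟩ := 𝓕.cls_surj c
    exact 𝓕.cls_eq (hx := 𝓕.mul_mem hx (add_mem hy hz))
      (hy := add_mem (𝓕.mul_mem hx hy) (𝓕.mul_mem hx hz)) |>.2 (by simp [mul_add])
  add_mul := by
    intro i j a b c
    obtain ⟨x, hx, rfl⟩ := 𝓕.cls_surj a
    obtain ⟨y, hy, rfl⟩ := 𝓕.cls_surj b
    obtain ⟨z, hz, rfl⟩ := 𝓕.cls_surj c
    exact 𝓕.cls_eq (hx := 𝓕.mul_mem (add_mem hx hy) hz)
      (hy := add_mem (𝓕.mul_mem hx hz) (𝓕.mul_mem hy hz)) |>.2 (by simp [add_mul])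
  natCast m := m • 𝓕.cls 0 1 𝓕.one_mem
  natCast_zero := zero_smul _ _
  natCast_succ m := succ_nsmul _ m

instance : DirectSum.GAlgebra k 𝓕.gr where
  toFun := (LinearMap.toSpanSingleton k (𝓕.gr 0) (𝓕.cls 0 1 𝓕.one_mem)).toAddMonoidHom
  map_one := one_smul k (𝓕.cls 0 1 𝓕.one_mem)
  map_mul r s := 𝓕.mk_cls_eq (i := 0) (j := 0) rfl
    (x := (r * s) • (1 : D)) (y := (r • (1 : D)) * (s • (1 : D)))
    (by simp [smul_smul, mul_comm])
    (Submodule.smul_mem _ _ 𝓕.one_mem)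
    (𝓕.mul_mem (i := 0) (j := 0) (Submodule.smul_mem _ _ 𝓕.one_mem)
      (Submodule.smul_mem _ _ 𝓕.one_mem))
  commutes r := by
    rintro ⟨i, a⟩
    obtain ⟨x, hx, rfl⟩ := 𝓕.cls_surj a
    exact 𝓕.mk_cls_eq (x := (r • (1 : D)) * x) (y := x * (r • (1 : D)))
      ((zero_add i).trans (add_zero i).symm) (by simp)
      (𝓕.mul_mem (Submodule.smul_mem _ _ 𝓕.one_mem) hx)
      (𝓕.mul_mem hx (Submodule.smul_mem _ _ 𝓕.one_mem))
  smul_def r := by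
    rintro ⟨i, a⟩
    obtain ⟨x, hx, rfl⟩ := 𝓕.cls_surj a
    exact 𝓕.mk_cls_eq (x := r • x) (y := (r • (1 : D)) * x)
      (zero_add i).symm (by simp) (Submodule.smul_mem _ _ hx)
      (𝓕.mul_mem (Submodule.smul_mem _ _ 𝓕.one_mem) hx)

/-- The filtration of `B` inherited from a filtration of `D` through a surjection `D → B`. -/
def map {B : Type*} [Ring B] [Algebra k B] (f : D →ₐ[k] B) (hf : Function.Surjective f) :
    AlgFiltration k B where
  F i := (𝓕.F i).map f.toLinearMap
  mono _ _ h := Submodule.map_mono (𝓕.mono h)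
  one_mem := ⟨1, 𝓕.one_mem, map_one f⟩
  mul_mem := by
    rintro i j _ _ ⟨x, hx, rfl⟩ ⟨y, hy, rfl⟩
    exact ⟨x * y, 𝓕.mul_mem hx hy, map_mul f x y⟩
  exhaustive b := by
    obtain ⟨x, rfl⟩ := hf b
    obtain ⟨i, hi⟩ := 𝓕.exhaustive x
    exact ⟨i, x, hi, rfl⟩

end AlgFiltration

/-- `(D, 𝓕)` is a PBW deformation of the algebra `A` with grading `𝒜`: the associated graded
algebra `⨁ i, F^i(D) / F^{i-1}(D)` is isomorphic to `A` as a graded algebra, i.e. by an isomorphism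
of `k`-algebras that carries `𝒜 i` onto the degree `i` part for every `i`. -/
def IsPBWDeformation {k A D : Type*} [Field k] [Ring A] [Algebra k A] [Ring D] [Algebra k D]
    (𝒜 : ℕ → Submodule k A) (𝓕 : AlgFiltration k D) : Prop :=
  ∃ e : A ≃ₐ[k] DirectSum ℕ 𝓕.gr,
    ∀ i, (𝒜 i).map e.toLinearMap = LinearMap.range (DirectSum.lof k ℕ 𝓕.gr i)

namespace QuadMonomial

section TensorAlg

variable (k V : Type*) [Field k] [AddCommGroup V] [Module k V]

/-- The degree `i` part `V^{⊗ i}` of the tensor algebra `T(V)`. -/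
def tensorDeg (i : ℕ) : Submodule k (TensorAlgebra k V) :=
  LinearMap.range (TensorAlgebra.ι k : V →ₗ[k] TensorAlgebra k V) ^ i

/-- The filtration `F^j(T(V)) = ⨁_{i ≤ j} V^{⊗ i}` of the tensor algebra. -/
def tensorFiltration : AlgFiltration k (TensorAlgebra k V) where
  F j := ⨆ i ≤ j, tensorDeg k V i
  mono _ _ h := biSup_mono fun _ hi => hi.trans h
  one_mem := Submodule.mem_iSup_of_mem 0 (Submodule.mem_iSup_of_mem le_rfl
    (by rw [tensorDeg, pow_zero]; exact Submodule.one_le.1 le_rfl))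
  mul_mem := by
    intro i j x y hx hy
    have h : (⨆ a ≤ i, tensorDeg k V a) * (⨆ b ≤ j, tensorDeg k V b) ≤
        ⨆ c ≤ i + j, tensorDeg k V c := by
      simp only [Submodule.iSup_mul, Submodule.mul_iSup]
      refine iSup₂_le fun b hb => iSup₂_le fun a ha => ?_
      simp only [tensorDeg]
      rw [← pow_add]
      exact le_iSup₂_of_le (a + b) (by omega) le_rfl
    exact h (Submodule.mul_mem_mul hx hy)
  exhaustive x := by
    have hmono : Monotone fun j => ⨆ i ≤ j, tensorDeg k V i :=
      fun _ _ h => biSup_mono fun _ hi => hi.trans h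
    have hx : x ∈ ⨆ j, ⨆ i ≤ j, tensorDeg k V i := by
      have htop : (⨆ i, tensorDeg k V i) = ⊤ :=
        (DirectSum.Decomposition.isInternal
          (LinearMap.range (TensorAlgebra.ι k : V →ₗ[k] TensorAlgebra k V) ^ ·)).submodule_iSup_eq_top
      have hle : (⨆ i, tensorDeg k V i) ≤ ⨆ j, ⨆ i ≤ j, tensorDeg k V i :=
        iSup_le fun i => le_iSup_of_le i (le_iSup₂_of_le i le_rfl le_rfl)
      exact hle (htop ▸ Submodule.mem_top)
    exact (Submodule.mem_iSup_of_directed _ hmono.directed_le).1 hx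

variable {k V}

/-- The quotient `T(V) / (X)` by the two-sided ideal generated by a set `X`. -/
abbrev TQuot (X : Set (TensorAlgebra k V)) : Type _ :=
  TensorAlgebra k V ⧸ (TwoSidedIdeal.span X).asIdeal

/-- The projection `T(V) → T(V) / (X)`. -/
def toTQuot (X : Set (TensorAlgebra k V)) : TensorAlgebra k V →ₐ[k] TQuot X :=
  Ideal.Quotient.mkₐ k (TwoSidedIdeal.span X).asIdeal

theorem toTQuot_surjective (X : Set (TensorAlgebra k V)) : Function.Surjective (toTQuot X) :=
  Ideal.Quotient.mkₐ_surjective k _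

/-- The images of the subspaces `V^{⊗ i}` in `T(V) / (X)`; for homogeneous `X` this is the grading
inherited from `T(V)`. -/
def inheritedGrading (X : Set (TensorAlgebra k V)) (i : ℕ) : Submodule k (TQuot X) :=
  (tensorDeg k V i).map (toTQuot X).toLinearMap

/-- The filtration of `T(V) / (X)` inherited from `T(V)`. -/
def inheritedFiltration (X : Set (TensorAlgebra k V)) : AlgFiltration k (TQuot X) :=
  (tensorFiltration k V).map (toTQuot X) (toTQuot_surjective X)

/-- `P = {r - α(r) - β(r) : r ∈ R}`. -/
def deformedRel {R : Submodule k (TensorAlgebra k V)} (α : R →ₗ[k] V) (β : R →ₗ[k] k) :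
    Set (TensorAlgebra k V) :=
  Set.range fun r : R =>
    (r : TensorAlgebra k V) - TensorAlgebra.ι k (α r) - algebraMap k (TensorAlgebra k V) (β r)

end TensorAlg

variable {k V : Type*} [Field k] [AddCommGroup V] [Module k V] {n : ℕ}

/-- The quadratic monomial `x_i x_j` in `T(V)`. -/
noncomputable def quadMon (x : Module.Basis (Fin n) k V) (i j : Fin n) : TensorAlgebra k V :=
  TensorAlgebra.ι k (x i) * TensorAlgebra.ι k (x j)

/-- The span `R` of the monomials `x_i x_j` with `(i, j) ∈ S`. -/
def relSpace (x : Module.Basis (Fin n) k V) (S : Set (Fin n × Fin n)) :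
    Submodule k (TensorAlgebra k V) :=
  Submodule.span k {t | ∃ i j, (i, j) ∈ S ∧ t = quadMon x i j}

variable {R : Submodule k (TensorAlgebra k V)}

open Classical in
/-- The filtration parameter `a_m^{ij}`: the coefficient of `x_m` in `α(x_i x_j)` for
`x_i x_j ∈ R`, and zero by convention if `x_i x_j ∉ R`. -/
noncomputable def aPar (x : Module.Basis (Fin n) k V) (α : R →ₗ[k] V) (m i j : Fin n) : k :=
  if h : quadMon x i j ∈ R then x.repr (α ⟨quadMon x i j, h⟩) m else 0

open Classical in
/-- The filtration parameter `b^{ij} = β(x_i x_j)` for `x_i x_j ∈ R`, and zero by convention if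
`x_i x_j ∉ R`. -/
noncomputable def bPar (x : Module.Basis (Fin n) k V) (β : R →ₗ[k] k) (i j : Fin n) : k :=
  if h : quadMon x i j ∈ R then β ⟨quadMon x i j, h⟩ else 0

open Classical in
/-- The quantity `d_r^{ijl}`. -/
noncomputable def dPar (x : Module.Basis (Fin n) k V) (α : R →ₗ[k] V) (r i j l : Fin n) : k :=
  (∑ m with quadMon x m l ∈ R, aPar x α m i j * aPar x α r m l) -
    ∑ m' with quadMon x i m' ∈ R, aPar x α r i m' * aPar x α m' j l

end QuadMonomial

/-! The argument is a diamond lemma. Read each relation as a rule that replaces x_i x_j in R by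
α(x_i x_j) + β(x_i x_j). Words with no factor in R (normal words) span D compatibly with the
filtration, and those of length l give a basis of A_l. So the classes of normal words of length l
span gr_l, and PBW amounts to their independence for every l, that is, to independence of the normal
words in D.

Independence is governed by the overlaps x_i x_j x_l with both factors in R. Conditions (I), (II),
(III) say that the parts of length two, one and zero of the difference of the two reductions vanish
(`overlap_sub`). If normal words are independent, associativity in D forces this, coefficient by
coefficient (`confluent_of_injOn`). Conversely, if all overlaps resolve, multiplying by a letter and
reducing makes the span of normal words a T(V)-module killed by P (`leftMulLin_leftMul`,
`normalAction_relator`). A normal word applied to the empty word returns itself, so no nontrivial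
combination vanishes in D (`wordMap_injOn`).

An abstract graded isomorphism is enough for one direction, because `grMap` is then a surjection
between spaces of equal finite dimension. For the other, injectivity of every `grMap` makes the
canonical map `quotToGr` from A an isomorphism. -/

namespace QuadMonomial

/-! ### Rewriting of words and resolution of overlaps. -/

section Rewriting

open Finsupp

variable {k : Type*} [Field k] {n : ℕ}

/-- A word is normal if no two consecutive letters form a pair in `S`. -/
def Normal (S : Set (Fin n × Fin n)) (w : List (Fin n)) : Prop :=
  w.IsChain fun i j => (i, j) ∉ S

theorem Normal.tail {S : Set (Fin n × Fin n)} {i : Fin n} {w : List (Fin n)}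
    (h : Normal S (i :: w)) : Normal S w :=
  List.IsChain.tail h

theorem normal_cons_cons {S : Set (Fin n × Fin n)} {i j : Fin n} {w : List (Fin n)} :
    Normal S (i :: j :: w) ↔ (i, j) ∉ S ∧ Normal S (j :: w) :=
  List.isChain_cons_cons

open Classical in
/-- The normal form of `x_i w` for a normal word `w`, obtained by the rewriting rules
`x_i x_j ↦ ∑ m, a m i j x_m + b i j` for `(i, j) ∈ S`. -/
noncomputable def leftMul (S : Set (Fin n × Fin n)) (a : Fin n → Fin n → Fin n → k)
    (b : Fin n → Fin n → k) : List (Fin n) → Fin n → (List (Fin n) →₀ k)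
  | [], i => single [i] 1
  | j :: w, i =>
    if (i, j) ∈ S then ∑ m, a m i j • leftMul S a b w m + b i j • single w 1
    else single (i :: j :: w) 1

/-- The linear extension of `leftMul` in the word. -/
noncomputable def leftMulLin (S : Set (Fin n × Fin n)) (a : Fin n → Fin n → Fin n → k)
    (b : Fin n → Fin n → k) (i : Fin n) : (List (Fin n) →₀ k) →ₗ[k] (List (Fin n) →₀ k) :=
  linearCombination k fun w => leftMul S a b w i

variable (S : Set (Fin n × Fin n)) (a : Fin n → Fin n → Fin n → k) (b : Fin n → Fin n → k)

theorem leftMul_cons_of_mem {i j : Fin n} (h : (i, j) ∈ S) (w : List (Fin n)) :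
    leftMul S a b (j :: w) i = ∑ m, a m i j • leftMul S a b w m + b i j • single w 1 := by
  rw [leftMul, if_pos h]

theorem leftMul_of_normal {i : Fin n} {w : List (Fin n)} (h : Normal S (i :: w)) :
    leftMul S a b w i = single (i :: w) 1 := by
  cases w with
  | nil => rfl
  | cons j w => rw [leftMul, if_neg (normal_cons_cons.1 h).1]

@[simp]
theorem leftMulLin_single (i : Fin n) (w : List (Fin n)) :
    leftMulLin S a b i (single w 1) = leftMul S a b w i := by
  simp [leftMulLin]

/-- Combinations of normal words of length at most `l`. -/
noncomputable def normalLE (k : Type*) [Field k] (S : Set (Fin n × Fin n)) (l : ℕ) :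
    Submodule k (List (Fin n) →₀ k) :=
  supported k k {w | Normal S w ∧ w.length ≤ l}

theorem normalLE_mono : Monotone (normalLE k S) :=
  fun _ _ h => supported_mono fun _ hv => ⟨hv.1, hv.2.trans h⟩

theorem normalLE_le_supported (l : ℕ) : normalLE k S l ≤ supported k k {w | Normal S w} :=
  supported_mono fun _ hv => hv.1

/-- A rewrite replaces two letters by at most one, so reduction never lengthens a word. This bound
is what later ties reduction to the filtration. -/
theorem leftMul_mem {w : List (Fin n)} (hw : Normal S w) (i : Fin n) :
    leftMul S a b w i ∈ normalLE k S (w.length + 1) := by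
  induction w generalizing i with
  | nil => exact single_mem_supported _ _ ⟨List.isChain_singleton _, by simp⟩
  | cons j w ih =>
    by_cases h : (i, j) ∈ S
    · rw [leftMul_cons_of_mem _ _ _ h]
      have hle : normalLE k S (w.length + 1) ≤ normalLE k S ((j :: w).length + 1) :=
        normalLE_mono S (by simp)
      refine add_mem (sum_mem fun m _ => Submodule.smul_mem _ _ (hle (ih hw.tail m)))
        (Submodule.smul_mem _ _ (single_mem_supported _ _ ⟨hw.tail, by simp; omega⟩))
    · rw [leftMul_of_normal _ _ _ (normal_cons_cons.2 ⟨h, hw⟩)]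
      exact single_mem_supported _ _ ⟨normal_cons_cons.2 ⟨h, hw⟩, by simp⟩

theorem leftMulLin_mem_normalLE {l : ℕ} {f : List (Fin n) →₀ k} (hf : f ∈ normalLE k S l)
    (i : Fin n) : leftMulLin S a b i f ∈ normalLE k S (l + 1) := by
  refine sum_mem fun w hw => Submodule.smul_mem _ _ ?_
  have h : Normal S w ∧ w.length ≤ l := (mem_supported k f).1 hf hw
  exact normalLE_mono S (Nat.succ_le_succ h.2) (leftMul_mem S a b h.1 i)

theorem leftMulLin_mem_supported {f : List (Fin n) →₀ k}
    (hf : f ∈ supported k k {w | Normal S w}) (i : Fin n) :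
    leftMulLin S a b i f ∈ supported k k {w | Normal S w} := by
  refine sum_mem fun w hw => Submodule.smul_mem _ _ ?_
  exact normalLE_le_supported S _ (leftMul_mem S a b ((mem_supported k f).1 hf hw) i)

open Classical in
/-- The coefficient of `x_r` in the reduction of the overlap `x_i x_j x_l`, without the
contribution of `b`. -/
noncomputable def overlapCoeff (r i j l : Fin n) : k :=
  (∑ m with (m, l) ∈ S, a m i j * a r m l) - ∑ m' with (i, m') ∈ S, a r i m' * a m' j l

open Classical in
/-- The conditions under which all overlaps `x_i x_j x_l` can be resolved. -/
def Confluent : Prop :=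
  ∀ i j l : Fin n, (i, j) ∈ S → (j, l) ∈ S →
    ((∀ m, m ≠ i → (m, l) ∉ S → a m i j = 0) ∧
      (∀ m', m' ≠ l → (i, m') ∉ S → a m' j l = 0) ∧
      ((i, l) ∉ S → a i i j = a l j l)) ∧
    ((i ≠ l →
        (∀ r, r ≠ i → r ≠ l → overlapCoeff S a r i j l = 0) ∧
        overlapCoeff S a l i j l = -b i j ∧
        overlapCoeff S a i i j l = b j l) ∧
      (i = l →
        (∀ r, r ≠ i → overlapCoeff S a r i j l = 0) ∧
        overlapCoeff S a i i j l = b j i - b i j)) ∧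
    (∑ m with (m, l) ∈ S, a m i j * b m l) - (∑ m' with (i, m') ∈ S, b i m' * a m' j l) = 0

variable {S a b}

/-- Merges the two cases of (II) into one identity: the indicator terms come from the leftover
summands b^{ij} x_l and b^{jl} x_i, which fall on the same letter when i = l. -/
theorem linear_part_iff {d : Fin n → k} {i l : Fin n} {c c' c'' : k} (hc : i = l → c' = c'') :
    ((i ≠ l → (∀ r, r ≠ i → r ≠ l → d r = 0) ∧ d l = -c ∧ d i = c') ∧
      (i = l → (∀ r, r ≠ i → d r = 0) ∧ d i = c'' - c)) ↔
    ∀ r, d r + (if r = l then c else 0) - (if r = i then c' else 0) = 0 := by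
  by_cases hil : i = l
  · subst hil
    simp only [ne_eq, not_true_eq_false, false_imp_iff, true_and, true_imp_iff, ← hc rfl]
    constructor
    · rintro ⟨h1, h2⟩ r
      by_cases hr : r = i
      · simp [hr, h2]
      · simp [hr, h1 r hr]
    · intro h
      refine ⟨fun r hr => by simpa [hr] using h r, ?_⟩
      have := h i
      simp only [if_true] at this
      linear_combination this
  · simp only [ne_eq, hil, not_false_eq_true, true_imp_iff, false_imp_iff, and_true]
    constructor
    · rintro ⟨h1, h2, h3⟩ r
      by_cases hr : r = i
      · subst hr; simp [hil, h3]
      · by_cases hr' : r = l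
        · subst hr'; simp [hr, h2]
        · simp [hr, hr', h1 r hr hr']
    · intro h
      refine ⟨fun r hr hr' => by simpa [hr, hr'] using h r, ?_, ?_⟩
      · have := h l
        simp only [if_true, if_neg (Ne.symm hil)] at this
        linear_combination this
      · have := h i
        simp only [if_true, if_neg hil] at this
        linear_combination this

open Classical in
/-- The difference of the two reductions of `x_i x_j x_l`, in terms of arbitrary values `q p r`,
`u r`, `o` of `x_p x_r`, `x_r`, `1` that obey the rewriting rules. -/
theorem overlap_sub {N : Type*} [AddCommGroup N] [Module k N] {q : Fin n → Fin n → N}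
    {u : Fin n → N} {o : N}
    (hq : ∀ p r, (p, r) ∈ S → q p r = ∑ m, a m p r • u m + b p r • o) (i j l : Fin n) :
    (∑ m, a m i j • q m l + b i j • u l) - (∑ m, a m j l • q i m + b j l • u i) =
      ((∑ m with (m, l) ∉ S, a m i j • q m l) - ∑ m with (i, m) ∉ S, a m j l • q i m) +
      ∑ r, (overlapCoeff S a r i j l + (if r = l then b i j else 0) -
        (if r = i then b j l else 0)) • u r +
      ((∑ m with (m, l) ∈ S, a m i j * b m l) -
        ∑ m' with (i, m') ∈ S, b i m' * a m' j l) • o := by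
  have h1 : ∑ m, a m i j • q m l = (∑ m with (m, l) ∉ S, a m i j • q m l) +
      ((∑ r, (∑ m with (m, l) ∈ S, a m i j * a r m l) • u r) +
        (∑ m with (m, l) ∈ S, a m i j * b m l) • o) := by
    -- Only the terms whose pair lies in `S` can be rewritten once more; the others stay quadratic.
    rw [← Finset.sum_filter_not_add_sum_filter Finset.univ (fun m => (m, l) ∈ S)]
    congr 1
    rw [Finset.sum_congr rfl fun m hm => by
      rw [hq m l (Finset.mem_filter.1 hm).2, smul_add, Finset.smul_sum]]
    simp only [Finset.sum_add_distrib, Finset.sum_smul, smul_smul]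
    rw [Finset.sum_comm]
  have h2 : ∑ m, a m j l • q i m = (∑ m with (i, m) ∉ S, a m j l • q i m) +
      ((∑ r, (∑ m with (i, m) ∈ S, a r i m * a m j l) • u r) +
        (∑ m with (i, m) ∈ S, b i m * a m j l) • o) := by
    rw [← Finset.sum_filter_not_add_sum_filter Finset.univ (fun m => (i, m) ∈ S)]
    congr 1
    rw [Finset.sum_congr rfl fun m hm => by
      rw [hq i m (Finset.mem_filter.1 hm).2, smul_add, Finset.smul_sum]]
    simp only [Finset.sum_add_distrib, Finset.sum_smul, smul_smul]
    rw [Finset.sum_comm]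
    simp only [mul_comm]
  rw [h1, h2]
  simp only [overlapCoeff, sub_smul, add_smul, Finset.sum_sub_distrib, Finset.sum_add_distrib,
    ite_smul, zero_smul, Finset.sum_ite_eq', Finset.mem_univ, if_true]
  abel

-- Associativity: both reductions compute the product y_i y_j y_l, so their difference vanishes in
-- any algebra satisfying the relations.
open Classical in
theorem overlap_sub_eq_zero {B : Type*} [Ring B] [Algebra k B] {y : Fin n → B}
    (hy : ∀ p r, (p, r) ∈ S → y p * y r = ∑ m, a m p r • y m + b p r • 1) {i j l : Fin n}
    (hij : (i, j) ∈ S) (hjl : (j, l) ∈ S) :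
    ((∑ m with (m, l) ∉ S, a m i j • (y m * y l)) - ∑ m with (i, m) ∉ S, a m j l • (y i * y m)) +
      ∑ r, (overlapCoeff S a r i j l + (if r = l then b i j else 0) -
        (if r = i then b j l else 0)) • y r +
      ((∑ m with (m, l) ∈ S, a m i j * b m l) -
        ∑ m' with (i, m') ∈ S, b i m' * a m' j l) • 1 = 0 := by
  have e := @overlap_sub k _ n S a b B _ _ (fun p r => y p * y r) y (1 : B)
  rw [← e hy]
  refine sub_eq_zero.2 ?_
  calc ∑ m, a m i j • (y m * y l) + b i j • y l = y i * y j * y l := by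
        rw [hy i j hij]; simp [add_mul, Finset.sum_mul]
    _ = y i * (y j * y l) := mul_assoc _ _ _
    _ = ∑ m, a m j l • (y i * y m) + b j l • y i := by
        rw [hy j l hjl]; simp [mul_add, Finset.mul_sum]

open Classical in
theorem Confluent.overlap_eq (h : Confluent S a b) {N : Type*} [AddCommGroup N] [Module k N]
    {q : Fin n → Fin n → N} {u : Fin n → N} {o : N}
    (hq : ∀ p r, (p, r) ∈ S → q p r = ∑ m, a m p r • u m + b p r • o) {i j l : Fin n}
    (hij : (i, j) ∈ S) (hjl : (j, l) ∈ S) :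
    ∑ m, a m i j • q m l + b i j • u l = ∑ m, a m j l • q i m + b j l • u i := by
  obtain ⟨⟨h1, h2, h3⟩, h4, h5⟩ := h i j l hij hjl
  rw [linear_part_iff (by rintro rfl; rfl)] at h4
  rw [← sub_eq_zero, overlap_sub hq, h5]
  simp only [h4, zero_smul, Finset.sum_const_zero, add_zero]
  rw [sub_eq_zero]
  -- If (i, l) ∈ S, the indices exempted in (a) and (b) do not occur in the filtered sums, so all
  -- quadratic terms vanish. Otherwise only m = i in one sum and m = l in the other survive; both
  -- carry `q i l`, and (c) equates their coefficients.
  by_cases hil : (i, l) ∈ S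
  · rw [Finset.sum_eq_zero, Finset.sum_eq_zero]
    · intro m hm
      have hm := (Finset.mem_filter.1 hm).2
      rw [h2 m (by rintro rfl; exact hm hil) hm, zero_smul]
    · intro m hm
      have hm := (Finset.mem_filter.1 hm).2
      rw [h1 m (by rintro rfl; exact hm hil) hm, zero_smul]
  · rw [Finset.sum_eq_single_of_mem i (by simpa using hil),
      Finset.sum_eq_single_of_mem l (by simpa using hil), h3 hil]
    · intro m hm hne
      rw [h2 m hne (Finset.mem_filter.1 hm).2, zero_smul]
    · intro m hm hne
      rw [h1 m hne (Finset.mem_filter.1 hm).2, zero_smul]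

/-- The relations hold for the action on normal words. Only a word whose first letter l overlaps
with x_j needs work; the overlap identity is then applied to the elements x_p · (x_r · w), which
obey the rules by induction on the word. -/
theorem Confluent.leftMulLin_leftMul (h : Confluent S a b) {w : List (Fin n)} (hw : Normal S w)
    {i j : Fin n} (hij : (i, j) ∈ S) :
    leftMulLin S a b i (leftMul S a b w j) =
      ∑ m, a m i j • leftMul S a b w m + b i j • single w 1 := by
  induction w generalizing i j with
  | nil =>
    rw [leftMul_of_normal _ _ _ (List.isChain_singleton j), leftMulLin_single,
      leftMul_cons_of_mem _ _ _ hij]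
  | cons l w ih =>
    by_cases hjl : (j, l) ∈ S
    · have e := h.overlap_eq (q := fun p r => leftMulLin S a b p (leftMul S a b w r))
        (u := leftMul S a b w) (o := single w 1) (fun p r hpr => ih hw.tail hpr) hij hjl
      rw [leftMul_cons_of_mem _ _ _ hjl]
      simp only [map_add, map_sum, map_smul, leftMulLin_single]
      rw [← e]
      -- Since l :: w is normal, x_l · w is that word itself, so x_m · (x_l · w) is the action of
      -- x_m on it.
      simp only [leftMul_of_normal _ _ _ hw, leftMulLin_single]
    · rw [leftMul_of_normal _ _ _ (normal_cons_cons.2 ⟨hjl, hw⟩), leftMulLin_single,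
        leftMul_cons_of_mem _ _ _ hij]

end Rewriting

/-! ### Normal words in a quotient of the tensor algebra. -/

section Presentation

open Finsupp

variable {k V : Type*} [Field k] [AddCommGroup V] [Module k V] {n : ℕ}
  (x : Module.Basis (Fin n) k V)

/-- The monomial in `T(V)` given by a word. -/
noncomputable def word (w : List (Fin n)) : TensorAlgebra k V :=
  (w.map fun i => TensorAlgebra.ι k (x i)).prod

@[simp]
theorem word_nil : word x [] = 1 := rfl

theorem word_cons (i : Fin n) (w : List (Fin n)) :
    word x (i :: w) = TensorAlgebra.ι k (x i) * word x w := by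
  simp [word]

theorem tensorDeg_eq_span (l : ℕ) :
    tensorDeg k V l = Submodule.span k (word x '' {w | w.length = l}) := by
  have hι : LinearMap.range (TensorAlgebra.ι k : V →ₗ[k] TensorAlgebra k V) =
      Submodule.span k (Set.range fun i => TensorAlgebra.ι k (x i)) := by
    rw [← Submodule.map_top, ← x.span_eq, Submodule.map_span, ← Set.range_comp]; rfl
  induction l with
  | zero =>
    have h : ({w : List (Fin n) | w.length = 0} : Set _) = {[]} := by
      ext w; simp
    rw [tensorDeg, pow_zero, h, Set.image_singleton, word_nil, Submodule.one_eq_span]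
  | succ l ih =>
    rw [tensorDeg, pow_succ', ← tensorDeg, ih, hι, Submodule.span_mul_span]
    congr 1
    ext t
    constructor
    · rintro ⟨_, ⟨i, rfl⟩, _, ⟨w, hw, rfl⟩, rfl⟩
      exact ⟨i :: w, by simpa using hw, word_cons x i w⟩
    · rintro ⟨_ | ⟨i, w⟩, hw, rfl⟩
      · simp at hw
      · exact ⟨_, ⟨i, rfl⟩, _, ⟨w, by simpa using hw, rfl⟩, (word_cons x i w).symm⟩

/-- The relator `x_i x_j - ∑ m, a m i j x_m - b i j`. -/
noncomputable def relator (a : Fin n → Fin n → Fin n → k) (b : Fin n → Fin n → k)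
    (i j : Fin n) : TensorAlgebra k V :=
  quadMon x i j - ∑ m, a m i j • TensorAlgebra.ι k (x m) - algebraMap k (TensorAlgebra k V) (b i j)

/-- `X` spans the same subspace as the relators indexed by `S`. -/
def SpansRelators (S : Set (Fin n × Fin n)) (a : Fin n → Fin n → Fin n → k)
    (b : Fin n → Fin n → k) (X : Set (TensorAlgebra k V)) : Prop :=
  Submodule.span k X = Submodule.span k {t | ∃ i j, (i, j) ∈ S ∧ t = relator x a b i j}

/-- The combinations of words, evaluated in `T(V) / (X)`. -/
noncomputable def wordMap (X : Set (TensorAlgebra k V)) : (List (Fin n) →₀ k) →ₗ[k] TQuot X :=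
  linearCombination k fun w => toTQuot X (word x w)

@[simp]
theorem wordMap_single (X : Set (TensorAlgebra k V)) (w : List (Fin n)) (c : k) :
    wordMap x X (single w c) = c • toTQuot X (word x w) := by
  simp [wordMap]

theorem toTQuot_eq_zero_iff {X : Set (TensorAlgebra k V)} {t : TensorAlgebra k V} :
    toTQuot X t = 0 ↔ t ∈ TwoSidedIdeal.span X := by
  rw [← TwoSidedIdeal.mem_asIdeal]
  exact Ideal.Quotient.eq_zero_iff_mem

theorem inheritedFiltration_F (X : Set (TensorAlgebra k V)) (l : ℕ) :
    (inheritedFiltration X).F l =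
      Submodule.span k ((fun w => toTQuot X (word x w)) '' {w | w.length ≤ l}) := by
  have h : (inheritedFiltration X).F l =
      (⨆ i ≤ l, tensorDeg k V i).map (toTQuot X).toLinearMap := rfl
  rw [h]
  simp only [tensorDeg_eq_span x, Submodule.map_span, ← Submodule.span_iUnion]
  congr 1
  ext d
  simp

variable {x} {S : Set (Fin n × Fin n)} {a : Fin n → Fin n → Fin n → k}
  {b : Fin n → Fin n → k} {X : Set (TensorAlgebra k V)}

namespace SpansRelators

theorem toTQuot_quadMon (hX : SpansRelators x S a b X) {i j : Fin n} (h : (i, j) ∈ S) :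
    toTQuot X (quadMon x i j) =
      ∑ m, a m i j • toTQuot X (TensorAlgebra.ι k (x m)) + b i j • 1 := by
  have hle : Submodule.span k X ≤ LinearMap.ker (toTQuot X).toLinearMap :=
    Submodule.span_le.2 fun t ht => toTQuot_eq_zero_iff.2 (TwoSidedIdeal.subset_span ht)
  rw [show Submodule.span k X = _ from hX] at hle
  have h0 : toTQuot X (relator x a b i j) = 0 := hle (Submodule.subset_span ⟨i, j, h, rfl⟩)
  rw [relator, map_sub, map_sub, sub_sub, sub_eq_zero] at h0
  rw [h0]
  simp [map_sum, Algebra.algebraMap_eq_smul_one]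

theorem eq_zero_of_toTQuot_eq_zero (hX : SpansRelators x S a b X) {B : Type*} [Semiring B]
    [Algebra k B] (f : TensorAlgebra k V →ₐ[k] B)
    (hf : ∀ i j, (i, j) ∈ S → f (relator x a b i j) = 0) {t : TensorAlgebra k V}
    (ht : toTQuot X t = 0) : f t = 0 := by
  have hle : Submodule.span k X ≤ LinearMap.ker f.toLinearMap := by
    rw [show Submodule.span k X = _ from hX, Submodule.span_le]
    rintro _ ⟨i, j, h, rfl⟩
    exact hf i j h
  have h : TwoSidedIdeal.span X ≤ TwoSidedIdeal.ker f :=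
    TwoSidedIdeal.span_le.2 fun s hs =>
      (TwoSidedIdeal.mem_ker f).2 (hle (Submodule.subset_span hs))
  exact (TwoSidedIdeal.mem_ker f).1 (h (toTQuot_eq_zero_iff.1 ht))

/-- Reduction does not change the value in the quotient; no confluence is involved. -/
theorem wordMap_leftMul (hX : SpansRelators x S a b X) (w : List (Fin n)) (i : Fin n) :
    wordMap x X (leftMul S a b w i) = toTQuot X (word x (i :: w)) := by
  induction w generalizing i with
  | nil => simp [leftMul]
  | cons j w ih =>
    by_cases h : (i, j) ∈ S
    · rw [leftMul_cons_of_mem _ _ _ h, word_cons, word_cons, ← mul_assoc, map_mul]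
      change _ = toTQuot X (quadMon x i j) * _
      rw [hX.toTQuot_quadMon h]
      simp [map_sum, ih, add_mul, Finset.sum_mul, word_cons]
    · rw [leftMul, if_neg h, wordMap_single, one_smul]

theorem wordMap_leftMulLin (hX : SpansRelators x S a b X) (f : List (Fin n) →₀ k) (i : Fin n) :
    wordMap x X (leftMulLin S a b i f) =
      toTQuot X (TensorAlgebra.ι k (x i)) * wordMap x X f := by
  induction f using Finsupp.induction_linear with
  | zero => simp
  | add f g hf hg => simp [hf, hg, mul_add]
  | single w c =>
    rw [← mul_one c, ← smul_eq_mul, ← smul_single, map_smul, map_smul, leftMulLin_single,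
      hX.wordMap_leftMul, word_cons, map_mul, map_smul, wordMap_single, one_smul, mul_smul_comm]

theorem exists_normalLE (hX : SpansRelators x S a b X) (w : List (Fin n)) :
    ∃ f ∈ normalLE k S w.length, wordMap x X f = toTQuot X (word x w) := by
  induction w with
  | nil => exact ⟨single [] 1, single_mem_supported _ _ ⟨List.isChain_nil, le_rfl⟩, by simp⟩
  | cons i w ih =>
    obtain ⟨f, hf, he⟩ := ih
    exact ⟨leftMulLin S a b i f, leftMulLin_mem_normalLE S a b hf i,
      by rw [hX.wordMap_leftMulLin, he, word_cons, map_mul]⟩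

theorem map_normalLE (hX : SpansRelators x S a b X) (l : ℕ) :
    (normalLE k S l).map (wordMap x X) = (inheritedFiltration X).F l := by
  rw [inheritedFiltration_F x]
  apply le_antisymm
  · rw [normalLE, supported_eq_span_single, Submodule.map_span, Submodule.span_le]
    rintro _ ⟨_, ⟨w, hw, rfl⟩, rfl⟩
    exact Submodule.subset_span ⟨w, hw.2, by simp⟩
  · rw [Submodule.span_le]
    rintro _ ⟨w, hw, rfl⟩
    obtain ⟨f, hf, he⟩ := hX.exists_normalLE w
    exact ⟨f, normalLE_mono S hw hf, he⟩

theorem map_normalLE_pred (hX : SpansRelators x S a b X) (l : ℕ) :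
    (supported k k {w | Normal S w ∧ w.length < l}).map (wordMap x X) =
      (inheritedFiltration X).prev l := by
  cases l with
  | zero => simp [AlgFiltration.prev]
  | succ l =>
    have h := hX.map_normalLE l
    simp only [normalLE, ← Nat.lt_succ_iff] at h
    exact h

/-- The action of `T(V)` on combinations of normal words. -/
noncomputable def normalAction (S : Set (Fin n × Fin n)) (x : Module.Basis (Fin n) k V)
    (a : Fin n → Fin n → Fin n → k) (b : Fin n → Fin n → k) :
    TensorAlgebra k V →ₐ[k] Module.End k (supported k k {w : List (Fin n) | Normal S w}) :=
  TensorAlgebra.lift k (x.constr k fun i =>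
    (leftMulLin S a b i).restrict fun _ hf => leftMulLin_mem_supported S a b hf i)

theorem normalAction_ι (i : Fin n) (f : supported k k {w : List (Fin n) | Normal S w}) :
    (normalAction S x a b (TensorAlgebra.ι k (x i)) f : List (Fin n) →₀ k) =
      leftMulLin S a b i f := by
  simp [normalAction]

/-- This makes the action descend to the quotient; `key` is the linear extension of the relation
already checked on normal words. -/
theorem normalAction_relator (h : Confluent S a b) {i j : Fin n} (hij : (i, j) ∈ S) :
    normalAction S x a b (relator x a b i j) = 0 := by
  have key : ∀ f ∈ supported k k {w : List (Fin n) | Normal S w},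
      leftMulLin S a b i (leftMulLin S a b j f) =
        ∑ m, a m i j • leftMulLin S a b m f + b i j • f := by
    intro f hf
    rw [supported_eq_span_single] at hf
    induction hf using Submodule.span_induction with
    | mem f hf =>
      obtain ⟨w, hw, rfl⟩ := hf
      simpa using h.leftMulLin_leftMul hw hij
    | zero => simp
    | add f g _ _ hf hg =>
      simp only [map_add, hf, hg, smul_add, Finset.sum_add_distrib]; abel
    | smul c f _ hf =>
      simp only [map_smul, hf, smul_add, Finset.smul_sum, smul_comm c]
  refine LinearMap.ext fun f => Subtype.ext ?_
  have e : quadMon x i j = relator x a b i j +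
      (∑ m, a m i j • TensorAlgebra.ι k (x m) + algebraMap k _ (b i j)) := by
    rw [relator]; abel
  have e1 := congrArg (fun t => (normalAction S x a b t f : List (Fin n) →₀ k)) e
  rw [quadMon, map_mul, map_add, map_add, map_sum, AlgHom.commutes] at e1
  simp only [Module.End.mul_apply, normalAction_ι, key f f.2, LinearMap.add_apply,
    Submodule.coe_add, LinearMap.sum_apply, Submodule.coe_sum, Module.algebraMap_end_apply,
    Submodule.coe_smul, map_smul, LinearMap.smul_apply] at e1
  simpa using e1

theorem normalAction_word (w : List (Fin n)) (hw : Normal S w) :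
    (normalAction S x a b (word x w) ⟨single [] 1, single_mem_supported _ _ List.isChain_nil⟩ :
      List (Fin n) →₀ k) = single w 1 := by
  induction w with
  | nil => simp
  | cons i w ih =>
    rw [word_cons, map_mul, Module.End.mul_apply, normalAction_ι, ih hw.tail, leftMulLin_single,
      leftMul_of_normal _ _ _ hw]

/-- Normal words are linearly independent in a confluent quotient. -/
theorem wordMap_injOn (hX : SpansRelators x S a b X) (h : Confluent S a b)
    {f : List (Fin n) →₀ k} (hf : f ∈ supported k k {w | Normal S w})
    (h0 : wordMap x X f = 0) : f = 0 := by
  have h1 : wordMap x X f = toTQuot X (linearCombination k (word x) f) := by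
    simp [wordMap, linearCombination_apply, Finsupp.sum, map_sum]
  have h2 := hX.eq_zero_of_toTQuot_eq_zero (normalAction S x a b)
    (fun i j hij => normalAction_relator h hij) (h1.symm.trans h0)
  -- Evaluation at the empty word is a left inverse to sending a combination of normal words to its
  -- element of T(V).
  have h3 : ∀ f ∈ supported k k {w : List (Fin n) | Normal S w},
      (normalAction S x a b (linearCombination k (word x) f)
        ⟨single [] 1, single_mem_supported _ _ List.isChain_nil⟩ : List (Fin n) →₀ k) = f := by
    intro f hf
    rw [supported_eq_span_single] at hf
    induction hf using Submodule.span_induction with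
    | mem f hf =>
      obtain ⟨w, hw, rfl⟩ := hf
      simpa using normalAction_word w hw
    | zero => simp
    | add f g _ _ hf hg => simp [hf, hg]
    | smul c f _ hf => simp [hf]
  rw [← h3 f hf, h2]
  rfl

open Classical in
theorem confluent_of_injOn (hX : SpansRelators x S a b X)
    (h : ∀ f ∈ supported k k {w | Normal S w}, wordMap x X f = 0 → f = 0) : Confluent S a b := by
  intro i j l hij hjl
  -- The difference of the two reductions of x_i x_j x_l, lifted to a formal combination of normal
  -- words.
  set f : List (Fin n) →₀ k :=
    ((∑ m with (m, l) ∉ S, a m i j • single [m, l] 1) -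
        ∑ m with (i, m) ∉ S, a m j l • single [i, m] 1) +
      ∑ r, (overlapCoeff S a r i j l + (if r = l then b i j else 0) -
        (if r = i then b j l else 0)) • single [r] 1 +
      ((∑ m with (m, l) ∈ S, a m i j * b m l) -
        ∑ m' with (i, m') ∈ S, b i m' * a m' j l) • single [] 1 with hfdef
  have hfN : f ∈ supported k k {w | Normal S w} := by
    refine add_mem (add_mem (sub_mem (sum_mem fun m hm => ?_) (sum_mem fun m hm => ?_))
      (sum_mem fun r _ => ?_)) ?_ <;>
      refine Submodule.smul_mem _ _ (single_mem_supported _ _ ?_)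
    · exact normal_cons_cons.2 ⟨(Finset.mem_filter.1 hm).2, List.isChain_singleton _⟩
    · exact normal_cons_cons.2 ⟨(Finset.mem_filter.1 hm).2, List.isChain_singleton _⟩
    · exact List.isChain_singleton _
    · exact List.isChain_nil
  have hf0 : wordMap x X f = 0 := by
    have e := overlap_sub_eq_zero (y := fun r => toTQuot X (TensorAlgebra.ι k (x r)))
      (fun p r hpr => (map_mul _ _ _).symm.trans (hX.toTQuot_quadMon hpr)) hij hjl
    rw [hfdef]
    simp only [map_add, map_sub, map_sum, map_smul, wordMap_single, one_smul, word_cons, word_nil,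
      mul_one, map_one, map_mul]
    exact e
  have hf := h f hfN hf0
  have hval : ∀ w, f w = 0 := fun w => by rw [hf]; rfl
  -- Words from the first sum end in l and those from the second begin with i, so they can cancel
  -- only at [i, l]; this is the source of the exceptions in (a) and (b) and of the equality (c).
  have h2 : ∀ p q, (if q = l ∧ (p, l) ∉ S then a p i j else 0) -
      (if p = i ∧ (i, q) ∉ S then a q j l else 0) = 0 := by
    intro p q
    have := hval [p, q]
    simp only [hfdef, Finsupp.add_apply, Finsupp.sub_apply, Finsupp.finsetSum_apply,
      Finsupp.smul_apply, single_apply] at this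
    convert this using 1
    have e1 : ∑ m with (m, l) ∉ S, a m i j • (if [m, l] = [p, q] then (1 : k) else 0) =
        if q = l ∧ (p, l) ∉ S then a p i j else 0 := by
      rw [Finset.sum_filter, Finset.sum_eq_single p]
      · by_cases h1 : (p, l) ∈ S <;> by_cases h2 : q = l <;> simp [h1, h2, eq_comm (a := l)]
      · intro m _ hm
        simp [hm]
      · simp
    have e2 : ∑ m with (i, m) ∉ S, a m j l • (if [i, m] = [p, q] then (1 : k) else 0) =
        if p = i ∧ (i, q) ∉ S then a q j l else 0 := by
      rw [Finset.sum_filter, Finset.sum_eq_single q]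
      · by_cases h1 : (i, q) ∈ S <;> by_cases h2 : p = i <;> simp [h1, h2, eq_comm (a := i)]
      · intro m _ hm
        simp [hm]
      · simp
    rw [e1, e2]
    simp
  have h1 : ∀ r, overlapCoeff S a r i j l + (if r = l then b i j else 0) -
      (if r = i then b j l else 0) = 0 := by
    intro r
    have := hval [r]
    simp only [hfdef, Finsupp.add_apply, Finsupp.sub_apply, Finsupp.finsetSum_apply,
      Finsupp.smul_apply, single_apply] at this
    simpa using this
  have h0 : (∑ m with (m, l) ∈ S, a m i j * b m l) -
      ∑ m' with (i, m') ∈ S, b i m' * a m' j l = 0 := by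
    have := hval []
    simp only [hfdef, Finsupp.add_apply, Finsupp.sub_apply, Finsupp.finsetSum_apply,
      Finsupp.smul_apply, single_apply] at this
    simpa using this
  refine ⟨⟨fun m hm hml => ?_, fun m hm hml => ?_, fun hil => ?_⟩,
    (linear_part_iff (by rintro rfl; rfl)).2 h1, h0⟩
  · simpa [hm, hml] using h2 m l
  · simpa [hm, hml] using h2 i m
  · simpa [hil, sub_eq_zero] using h2 i l

end SpansRelators

end Presentation

/-! ### The associated graded algebra compared with normal words and with A. -/

section Graded

open Finsupp

variable {k V : Type*} [Field k] [AddCommGroup V] [Module k V] {n : ℕ}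
  {x : Module.Basis (Fin n) k V} {S : Set (Fin n × Fin n)} {a : Fin n → Fin n → Fin n → k}
  {b : Fin n → Fin n → k} {X Y : Set (TensorAlgebra k V)}

/-- Combinations of normal words of length `l`. -/
noncomputable def normalEQ (k : Type*) [Field k] (S : Set (Fin n × Fin n)) (l : ℕ) :
    Submodule k (List (Fin n) →₀ k) :=
  supported k k {w | Normal S w ∧ w.length = l}

theorem normalEQ_le_normalLE (l : ℕ) : normalEQ k S l ≤ normalLE k S l :=
  supported_mono fun _ hv => ⟨hv.1, hv.2.le⟩

theorem single_mem_normalEQ {w : List (Fin n)} (hw : Normal S w) (c : k) :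
    single w c ∈ normalEQ k S w.length :=
  single_mem_supported _ _ ⟨hw, rfl⟩

theorem normalEQ_hom_ext {N : Type*} [AddCommMonoid N] [Module k N] {l : ℕ}
    {g g' : normalEQ k S l →ₗ[k] N}
    (h : ∀ w (hw : Normal S w) (hl : w.length = l),
      g ⟨single w 1, hl ▸ single_mem_normalEQ hw 1⟩ =
        g' ⟨single w 1, hl ▸ single_mem_normalEQ hw 1⟩) : g = g' := by
  refine LinearMap.ext fun ⟨f, hf⟩ => ?_
  have hf' := hf
  rw [normalEQ, supported_eq_span_single] at hf'
  induction hf' using Submodule.span_induction with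
  | mem f hf' =>
    obtain ⟨w, ⟨hw, hl⟩, rfl⟩ := hf'
    exact h w hw hl
  | zero => exact (map_zero g).trans (map_zero g').symm
  | add f₁ f₂ h₁ h₂ ih₁ ih₂ =>
    rw [← supported_eq_span_single] at h₁ h₂
    exact (map_add g ⟨f₁, h₁⟩ ⟨f₂, h₂⟩).trans
      ((congrArg₂ (· + ·) (ih₁ h₁) (ih₂ h₂)).trans (map_add g' ⟨f₁, h₁⟩ ⟨f₂, h₂⟩).symm)
  | smul c f₁ h₁ ih₁ =>
    rw [← supported_eq_span_single] at h₁
    exact (map_smul g c ⟨f₁, h₁⟩).trans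
      ((congrArg (c • ·) (ih₁ h₁)).trans (map_smul g' c ⟨f₁, h₁⟩).symm)

theorem normalLE_eq_sup (l : ℕ) :
    normalLE k S l = normalEQ k S l ⊔ supported k k {w | Normal S w ∧ w.length < l} := by
  rw [normalLE, normalEQ, ← supported_union]
  congr 1
  ext w
  simp only [Set.mem_ofPred_eq, Set.mem_union, le_iff_eq_or_lt]
  tauto

instance (l : ℕ) : FiniteDimensional k (normalEQ k S l) := by
  have hfin : {w : List (Fin n) | Normal S w ∧ w.length = l}.Finite :=
    (List.finite_length_eq (Fin n) l).subset fun w hw => hw.2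
  have := hfin.to_subtype
  exact Module.Finite.equiv
    (supportedEquivFinsupp (M := k) (R := k) {w : List (Fin n) | Normal S w ∧ w.length = l}).symm

namespace SpansRelators

theorem wordMap_mem_F (hX : SpansRelators x S a b X) {l : ℕ} {f : List (Fin n) →₀ k}
    (hf : f ∈ normalEQ k S l) : wordMap x X f ∈ (inheritedFiltration X).F l := by
  rw [← hX.map_normalLE]
  exact ⟨f, normalEQ_le_normalLE l hf, rfl⟩

/-- The map sending a normal word of length `l` to its class in the associated graded algebra. -/
noncomputable def grMap (hX : SpansRelators x S a b X) (l : ℕ) :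
    normalEQ k S l →ₗ[k] (inheritedFiltration X).gr l :=
  (Submodule.mkQ _).comp
    (((wordMap x X).domRestrict (normalEQ k S l)).codRestrict ((inheritedFiltration X).F l)
      fun f => hX.wordMap_mem_F f.2)

theorem grMap_apply (hX : SpansRelators x S a b X) {l : ℕ} (f : normalEQ k S l) :
    hX.grMap l f = (inheritedFiltration X).cls l (wordMap x X f) (hX.wordMap_mem_F f.2) :=
  rfl

/-- Normal words of length at most l span F^l, and the shorter ones lie in F^{l-1}. -/
theorem grMap_surjective (hX : SpansRelators x S a b X) (l : ℕ) :
    Function.Surjective (hX.grMap l) := by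
  intro c
  obtain ⟨y, hy, rfl⟩ := AlgFiltration.cls_surj _ c
  have hy' := hy
  rw [← hX.map_normalLE, normalLE_eq_sup, Submodule.map_sup, hX.map_normalLE_pred] at hy'
  obtain ⟨_, ⟨f, hf, rfl⟩, z, hz, rfl⟩ := Submodule.mem_sup.1 hy'
  refine ⟨⟨f, hf⟩, ?_⟩
  rw [grMap_apply, AlgFiltration.cls_eq]
  simpa using neg_mem hz

theorem grMap_eq_zero_iff (hX : SpansRelators x S a b X) {l : ℕ} (f : normalEQ k S l) :
    hX.grMap l f = 0 ↔ wordMap x X f ∈ (inheritedFiltration X).prev l :=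
  Submodule.Quotient.mk_eq_zero _

theorem grMap_injective_of_confluent (hX : SpansRelators x S a b X) (h : Confluent S a b)
    (l : ℕ) : Function.Injective (hX.grMap l) := by
  rw [injective_iff_map_eq_zero]
  intro f hf
  rw [grMap_eq_zero_iff, ← hX.map_normalLE_pred] at hf
  obtain ⟨g, hg, hgf⟩ := hf
  have hfg : (f : List (Fin n) →₀ k) - g = 0 := by
    refine hX.wordMap_injOn h (sub_mem ?_ ?_) (by rw [map_sub, hgf, sub_self])
    · exact supported_mono (fun v hv => hv.1) f.2
    · exact supported_mono (fun v hv => hv.1) hg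
  have hd : Disjoint (normalEQ k S l) (supported k k {w | Normal S w ∧ w.length < l}) :=
    disjoint_supported_supported (Set.disjoint_left.2 fun w hw hw' => hw'.2.ne hw.2)
  rw [← sub_eq_zero.1 hfg] at hg
  exact Subtype.ext (Submodule.disjoint_def.1 hd _ f.2 hg)

/-- A relation among normal words has a top-length part that dies in the associated graded algebra;
injectivity kills that part, and one descends on the length. -/
theorem confluent_of_grMap_injective (hX : SpansRelators x S a b X)
    (h : ∀ l, Function.Injective (hX.grMap l)) : Confluent S a b := by
  apply hX.confluent_of_injOn
  have key : ∀ l, ∀ f ∈ supported k k {w : List (Fin n) | Normal S w ∧ w.length < l},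
      wordMap x X f = 0 → f = 0 := by
    intro l
    induction l with
    | zero => intro f hf _; simpa using hf
    | succ l ih =>
      intro f hf h0
      have hf' : f ∈ normalLE k S l := by simpa only [normalLE, Nat.lt_succ_iff] using hf
      rw [normalLE_eq_sup] at hf'
      obtain ⟨g, hg, g', hg', rfl⟩ := Submodule.mem_sup.1 hf'
      have hg0 : (⟨g, hg⟩ : normalEQ k S l) = 0 := by
        refine (injective_iff_map_eq_zero _).1 (h l) _ ?_
        rw [grMap_eq_zero_iff, ← hX.map_normalLE_pred]
        -- The total is zero, so the top part `g` has the value of `-g'`, which uses only shorter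
        -- words.
        refine ⟨-g', neg_mem hg', ?_⟩
        rw [map_add] at h0
        rw [map_neg]
        exact (eq_neg_of_add_eq_zero_left h0).symm
      obtain rfl : g = 0 := congrArg Subtype.val hg0
      rw [zero_add] at h0 ⊢
      exact ih g' hg' h0
  intro f hf h0
  refine key (f.support.sup List.length + 1) f ?_ h0
  exact fun w hw => ⟨hf hw, Nat.lt_succ_of_le (Finset.le_sup (f := List.length) hw)⟩

theorem confluent_zero : Confluent S (0 : Fin n → Fin n → Fin n → k) 0 := by
  intro i j l _ _
  simp [overlapCoeff]

theorem toTQuot_word_eq_zero (hY : SpansRelators x S 0 0 Y) {w : List (Fin n)}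
    (hw : ¬ Normal S w) : toTQuot Y (word x w) = 0 := by
  induction w with
  | nil => exact absurd List.isChain_nil hw
  | cons i w ih =>
    by_cases hw' : Normal S w
    · cases w with
      | nil => exact absurd (List.isChain_singleton i) hw
      | cons j w =>
        have hij : (i, j) ∈ S := by
          by_contra h
          exact hw (normal_cons_cons.2 ⟨h, hw'⟩)
        rw [← hY.wordMap_leftMul, leftMul_cons_of_mem _ _ _ hij]
        simp
    · rw [word_cons, map_mul, ih hw', mul_zero]

theorem map_normalEQ (hY : SpansRelators x S 0 0 Y) (l : ℕ) :
    (normalEQ k S l).map (wordMap x Y) = inheritedGrading Y l := by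
  rw [inheritedGrading, tensorDeg_eq_span x, normalEQ, supported_eq_span_single,
    Submodule.map_span, Submodule.map_span]
  apply le_antisymm <;> rw [Submodule.span_le]
  · rintro _ ⟨_, ⟨w, hw, rfl⟩, rfl⟩
    exact Submodule.subset_span ⟨_, ⟨w, hw.2, rfl⟩, by simp⟩
  · rintro _ ⟨_, ⟨w, hw, rfl⟩, rfl⟩
    by_cases hN : Normal S w
    · exact Submodule.subset_span ⟨_, ⟨w, ⟨hN, hw⟩, rfl⟩, by simp⟩
    · have h0 : (toTQuot Y).toLinearMap (word x w) = 0 := hY.toTQuot_word_eq_zero hN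
      rw [h0]
      exact zero_mem _

theorem wordMap_surjective (hX : SpansRelators x S a b X) : Function.Surjective (wordMap x X) := by
  intro d
  obtain ⟨l, hl⟩ := (inheritedFiltration X).exhaustive d
  rw [← hX.map_normalLE] at hl
  obtain ⟨f, -, rfl⟩ := hl
  exact ⟨f, rfl⟩

/-- A dimension count: the given isomorphism need not be related to `grMap`, but it identifies gr_l
with A_l and hence with the finite-dimensional space of normal words of length l. A surjective
endomorphism of that space is injective. -/
theorem grMap_injective_of_isPBWDeformation (hX : SpansRelators x S a b X)
    (hY : SpansRelators x S 0 0 Y)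
    (h : IsPBWDeformation (inheritedGrading Y) (inheritedFiltration X)) (l : ℕ) :
    Function.Injective (hX.grMap l) := by
  obtain ⟨e, he⟩ := h
  have hinj : Function.Injective ((wordMap x Y).domRestrict (normalEQ k S l)) := by
    rw [injective_iff_map_eq_zero]
    intro f hf
    exact Subtype.ext (hY.wordMap_injOn confluent_zero
      (supported_mono (fun v hv => hv.1) f.2) hf)
  have h1 : LinearMap.range ((wordMap x Y).domRestrict (normalEQ k S l)) =
      inheritedGrading Y l := by
    rw [LinearMap.range_domRestrict, hY.map_normalEQ]
  have hlof : Function.Injective (DirectSum.lof k ℕ (inheritedFiltration X).gr l) :=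
    DirectSum.of_injective l
  let E : (inheritedFiltration X).gr l ≃ₗ[k] normalEQ k S l :=
    (LinearEquiv.ofInjective _ hlof).trans <|
      (LinearEquiv.ofEq _ _ (he l).symm).trans <|
      (Submodule.equivMapOfInjective e.toLinearMap e.injective _).symm.trans <|
      (LinearEquiv.ofEq _ _ h1.symm).trans (LinearEquiv.ofInjective _ hinj).symm
  have hs : Function.Surjective (E.toLinearMap.comp (hX.grMap l)) :=
    E.surjective.comp (hX.grMap_surjective l)
  exact fun f g hfg =>
    OrzechProperty.injective_of_surjective_endomorphism _ hs (congrArg E hfg)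

/-! ### The canonical graded homomorphism from A to the associated graded algebra. -/

theorem ι_mem_F (X : Set (TensorAlgebra k V)) (i : Fin n) :
    toTQuot X (TensorAlgebra.ι k (x i)) ∈ (inheritedFiltration X).F 1 := by
  rw [inheritedFiltration_F x]
  exact Submodule.subset_span ⟨[i], by simp, by simp [word_cons]⟩

theorem word_mem_F (X : Set (TensorAlgebra k V)) (w : List (Fin n)) :
    toTQuot X (word x w) ∈ (inheritedFiltration X).F w.length := by
  rw [inheritedFiltration_F x]
  exact Submodule.subset_span ⟨w, le_refl w.length, rfl⟩

/-- The algebra map from `T(V)` to the associated graded algebra of `T(V) / (X)`. -/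
noncomputable def tensorToGr (x : Module.Basis (Fin n) k V) (X : Set (TensorAlgebra k V)) :
    TensorAlgebra k V →ₐ[k] DirectSum ℕ (inheritedFiltration X).gr :=
  TensorAlgebra.lift k (x.constr k fun i => DirectSum.of (inheritedFiltration X).gr 1
    ((inheritedFiltration X).cls 1 (toTQuot X (TensorAlgebra.ι k (x i))) (ι_mem_F X i)))

theorem tensorToGr_ι (X : Set (TensorAlgebra k V)) (i : Fin n) :
    tensorToGr x X (TensorAlgebra.ι k (x i)) = DirectSum.of (inheritedFiltration X).gr 1
      ((inheritedFiltration X).cls 1 (toTQuot X (TensorAlgebra.ι k (x i))) (ι_mem_F X i)) := by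
  rw [tensorToGr, TensorAlgebra.lift_ι_apply, Module.Basis.constr_basis]

theorem tensorToGr_word (X : Set (TensorAlgebra k V)) (w : List (Fin n)) :
    tensorToGr x X (word x w) = DirectSum.of (inheritedFiltration X).gr w.length
      ((inheritedFiltration X).cls w.length (toTQuot X (word x w)) (word_mem_F X w)) := by
  induction w with
  | nil =>
    exact (map_one _).trans (DirectSum.of_eq_of_gradedMonoid_eq (AlgFiltration.mk_cls_eq _ rfl
      (map_one (toTQuot X)).symm (AlgFiltration.one_mem _) _))
  | cons i w ih =>
    have e : tensorToGr x X (word x (i :: w)) =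
        tensorToGr x X (TensorAlgebra.ι k (x i)) * tensorToGr x X (word x w) := by
      rw [word_cons, map_mul]
    rw [e, ih, tensorToGr_ι, DirectSum.of_mul_of]
    refine DirectSum.of_eq_of_gradedMonoid_eq (AlgFiltration.mk_cls_eq _ (Nat.add_comm 1 w.length)
      ?_ (AlgFiltration.mul_mem _ (ι_mem_F X i) (word_mem_F X w)) _)
    rw [word_cons, map_mul]

theorem tensorToGr_relator (hX : SpansRelators x S a b X) {i j : Fin n} (h : (i, j) ∈ S) :
    tensorToGr x X (relator x 0 0 i j) = 0 := by
  have e : relator x (0 : Fin n → Fin n → Fin n → k) 0 i j = word x [i, j] := by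
    simp [relator, quadMon, word_cons]
  rw [e, tensorToGr_word]
  have h0 : (inheritedFiltration X).cls [i, j].length (toTQuot X (word x [i, j]))
      (word_mem_F X [i, j]) = 0 := by
    refine (Submodule.Quotient.mk_eq_zero _).2 ?_
    -- The class sits in degree 2, so it vanishes once the product lies in F^1; the deformed
    -- relation gives exactly this.
    change toTQuot X (word x [i, j]) ∈ (inheritedFiltration X).F 1
    have e' : word x [i, j] = quadMon x i j := by simp [quadMon, word_cons]
    rw [e', hX.toTQuot_quadMon h]
    refine add_mem (sum_mem fun m _ => Submodule.smul_mem _ _ (ι_mem_F X m))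
      (Submodule.smul_mem _ _ ?_)
    exact (inheritedFiltration X).mono zero_le_one (inheritedFiltration X).one_mem
  rw [h0, map_zero]

/-- The algebra map from the quotient by the monomials in `S` to the associated graded algebra. -/
noncomputable def quotToGr (hX : SpansRelators x S a b X) (hY : SpansRelators x S 0 0 Y) :
    TQuot Y →ₐ[k] DirectSum ℕ (inheritedFiltration X).gr :=
  Ideal.Quotient.liftₐ _ (tensorToGr x X) fun _ ht =>
    hY.eq_zero_of_toTQuot_eq_zero (tensorToGr x X) (fun _ _ h => hX.tensorToGr_relator h)
      (toTQuot_eq_zero_iff.2 (TwoSidedIdeal.mem_asIdeal.1 ht))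

theorem quotToGr_wordMap (hX : SpansRelators x S a b X) (hY : SpansRelators x S 0 0 Y)
    {l : ℕ} (f : normalEQ k S l) :
    hX.quotToGr hY (wordMap x Y f) =
      DirectSum.lof k ℕ (inheritedFiltration X).gr l (hX.grMap l f) := by
  refine LinearMap.congr_fun (f := (hX.quotToGr hY).toLinearMap.comp
    ((wordMap x Y).domRestrict (normalEQ k S l)))
    (g := (DirectSum.lof k ℕ (inheritedFiltration X).gr l).comp (hX.grMap l))
    (normalEQ_hom_ext fun w hw hl => ?_) f
  subst hl
  have e : wordMap x Y (single w 1) = toTQuot Y (word x w) := by simp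
  have e' : hX.grMap w.length ⟨single w 1, single_mem_normalEQ hw 1⟩ =
      (inheritedFiltration X).cls w.length (toTQuot X (word x w)) (word_mem_F X w) := by
    rw [grMap_apply, AlgFiltration.cls_eq]
    simp
  rw [LinearMap.comp_apply, LinearMap.comp_apply]
  erw [e']
  exact (congrArg (hX.quotToGr hY) e).trans (tensorToGr_word X w)

theorem quotToGr_surjective (hX : SpansRelators x S a b X) (hY : SpansRelators x S 0 0 Y) :
    Function.Surjective (hX.quotToGr hY) := by
  intro c
  induction c using DirectSum.induction_on with
  | zero => exact ⟨0, map_zero _⟩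
  | of l c =>
    obtain ⟨f, rfl⟩ := hX.grMap_surjective l c
    exact ⟨_, hX.quotToGr_wordMap hY f⟩
  | add c d hc hd =>
    obtain ⟨c, rfl⟩ := hc
    obtain ⟨d, rfl⟩ := hd
    exact ⟨c + d, map_add _ _ _⟩

theorem quotToGr_injective (hX : SpansRelators x S a b X) (hY : SpansRelators x S 0 0 Y)
    (h : ∀ l, Function.Injective (hX.grMap l)) : Function.Injective (hX.quotToGr hY) := by
  let E (l : ℕ) : normalEQ k S l ≃ₗ[k] (inheritedFiltration X).gr l :=
    LinearEquiv.ofBijective (hX.grMap l) ⟨h l, hX.grMap_surjective l⟩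
  -- A linear left inverse: in each degree, lift a class to its unique combination of normal words
  -- and evaluate it in A.
  let Ψ : DirectSum ℕ (inheritedFiltration X).gr →ₗ[k] TQuot Y :=
    DirectSum.toModule k ℕ _ fun l =>
      ((wordMap x Y).domRestrict (normalEQ k S l)).comp (E l).symm.toLinearMap
  have hΨ : (Ψ.comp (hX.quotToGr hY).toLinearMap).comp (wordMap x Y) = wordMap x Y := by
    refine Finsupp.lhom_ext' fun w => LinearMap.ext_ring ?_
    by_cases hw : Normal S w
    · have e := hX.quotToGr_wordMap hY ⟨single w 1, single_mem_normalEQ hw 1⟩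
      have e2 : Ψ (DirectSum.lof k ℕ (inheritedFiltration X).gr w.length
          (hX.grMap w.length ⟨single w 1, single_mem_normalEQ hw 1⟩)) =
          wordMap x Y (single w 1) := by
        rw [DirectSum.toModule_lof]
        have e3 : (E w.length).symm (hX.grMap w.length ⟨single w 1, single_mem_normalEQ hw 1⟩) =
            ⟨single w 1, single_mem_normalEQ hw 1⟩ := (E w.length).symm_apply_apply _
        rw [LinearMap.comp_apply, LinearEquiv.coe_coe, e3]
        rfl
      exact (congrArg Ψ e).trans e2
    · have h0 : wordMap x Y (single w 1) = 0 := by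
        rw [wordMap_single, hY.toTQuot_word_eq_zero hw, smul_zero]
      simp only [LinearMap.comp_apply, lsingle_apply, h0, map_zero]
  refine Function.LeftInverse.injective (g := Ψ) fun d => ?_
  obtain ⟨f, rfl⟩ := hY.wordMap_surjective d
  exact LinearMap.congr_fun hΨ f

theorem isPBWDeformation_of_grMap_injective (hX : SpansRelators x S a b X)
    (hY : SpansRelators x S 0 0 Y) (h : ∀ l, Function.Injective (hX.grMap l)) :
    IsPBWDeformation (inheritedGrading Y) (inheritedFiltration X) := by
  refine ⟨AlgEquiv.ofBijective (hX.quotToGr hY)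
    ⟨hX.quotToGr_injective hY h, hX.quotToGr_surjective hY⟩, fun l => ?_⟩
  rw [← hY.map_normalEQ]
  apply le_antisymm
  · rintro _ ⟨_, ⟨f, hf, rfl⟩, rfl⟩
    exact ⟨_, (hX.quotToGr_wordMap hY ⟨f, hf⟩).symm⟩
  · rintro _ ⟨c, rfl⟩
    obtain ⟨f, rfl⟩ := hX.grMap_surjective l c
    exact ⟨_, ⟨f, f.2, rfl⟩, hX.quotToGr_wordMap hY f⟩

/-- The PBW property is equivalent to the resolvability of all overlaps. -/
theorem isPBWDeformation_iff (hX : SpansRelators x S a b X) (hY : SpansRelators x S 0 0 Y) :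
    IsPBWDeformation (inheritedGrading Y) (inheritedFiltration X) ↔ Confluent S a b :=
  ⟨fun h => hX.confluent_of_grMap_injective (hX.grMap_injective_of_isPBWDeformation hY h),
    fun h => hX.isPBWDeformation_of_grMap_injective hY (hX.grMap_injective_of_confluent h)⟩

end SpansRelators

/-! ### Translation from R, α, β to indexed relators. -/

theorem relSpace_eq_span {S₀ : Set (Fin n × Fin n)} {R : Submodule k (TensorAlgebra k V)}
    (hR : R = relSpace x S₀) :
    R = Submodule.span k {t | ∃ i j, quadMon x i j ∈ R ∧ t = quadMon x i j} := by
  apply le_antisymm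
  · conv_lhs => rw [hR, relSpace]
    refine Submodule.span_mono ?_
    rintro _ ⟨i, j, hij, rfl⟩
    refine ⟨i, j, ?_, rfl⟩
    rw [hR]
    exact Submodule.subset_span ⟨i, j, hij, rfl⟩
  · rw [Submodule.span_le]
    rintro _ ⟨i, j, hij, rfl⟩
    exact hij

theorem spansRelators_relSpace {S₀ : Set (Fin n × Fin n)} {R : Submodule k (TensorAlgebra k V)}
    (hR : R = relSpace x S₀) :
    SpansRelators x {p | quadMon x p.1 p.2 ∈ R} 0 0 (R : Set (TensorAlgebra k V)) := by
  rw [SpansRelators, Submodule.span_eq]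
  conv_lhs => rw [relSpace_eq_span hR]
  simp [relator]

theorem spansRelators_deformedRel {S₀ : Set (Fin n × Fin n)}
    {R : Submodule k (TensorAlgebra k V)} (hR : R = relSpace x S₀) (α : R →ₗ[k] V)
    (β : R →ₗ[k] k) :
    SpansRelators x {p | quadMon x p.1 p.2 ∈ R} (aPar x α) (bPar x β) (deformedRel α β) := by
  let φ : R →ₗ[k] TensorAlgebra k V :=
    R.subtype - (TensorAlgebra.ι k).comp α - (Algebra.linearMap k (TensorAlgebra k V)).comp β
  have hφ : deformedRel α β = Set.range φ := rfl
  have hrel : ∀ i j (h : quadMon x i j ∈ R),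
      φ ⟨quadMon x i j, h⟩ = relator x (aPar x α) (bPar x β) i j := by
    intro i j h
    have hα : ∑ m, aPar x α m i j • TensorAlgebra.ι k (x m) =
        TensorAlgebra.ι k (α ⟨quadMon x i j, h⟩) := by
      simp only [aPar, dif_pos h, ← map_smul, ← map_sum, x.sum_repr]
    rw [relator, hα, bPar, dif_pos h]
    rfl
  rw [SpansRelators, hφ]
  apply le_antisymm <;> rw [Submodule.span_le]
  · rintro _ ⟨⟨t, ht⟩, rfl⟩
    have ht' := ht
    rw [relSpace_eq_span hR] at ht'
    induction ht' using Submodule.span_induction with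
    | mem t h =>
      obtain ⟨i, j, hij, rfl⟩ := h
      exact Submodule.subset_span ⟨i, j, hij, hrel i j hij⟩
    | zero =>
      have h0 : (⟨0, ht⟩ : R) = 0 := rfl
      rw [h0, map_zero]
      exact zero_mem _
    | add s t hs h ihs iht =>
      rw [← relSpace_eq_span hR] at hs h
      have h0 : (⟨s + t, ht⟩ : R) = ⟨s, hs⟩ + ⟨t, h⟩ := rfl
      rw [h0, map_add]
      exact add_mem (ihs hs) (iht h)
    | smul c t h iht =>
      rw [← relSpace_eq_span hR] at h
      have h0 : (⟨c • t, ht⟩ : R) = c • ⟨t, h⟩ := rfl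
      rw [h0, map_smul]
      exact Submodule.smul_mem _ _ (iht h)
  · rintro _ ⟨i, j, hij, rfl⟩
    exact Submodule.subset_span ⟨⟨quadMon x i j, hij⟩, hrel i j hij⟩

end Graded

end QuadMonomial

open Classical QuadMonomial in
theorem theorem3p6 {k V : Type*} [Field k] [AddCommGroup V] [Module k V] {n : ℕ}
    (x : Module.Basis (Fin n) k V) (S : Set (Fin n × Fin n))
    (R : Submodule k (TensorAlgebra k V)) (hR : R = relSpace x S)
    (α : R →ₗ[k] V) (β : R →ₗ[k] k) :
    IsPBWDeformation (inheritedGrading (R : Set (TensorAlgebra k V)))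
        (inheritedFiltration (deformedRel α β)) ↔
      ∀ i j l : Fin n, quadMon x i j ∈ R → quadMon x j l ∈ R →
        -- (I)
        ((∀ m, m ≠ i → quadMon x m l ∉ R → aPar x α m i j = 0) ∧
          (∀ m', m' ≠ l → quadMon x i m' ∉ R → aPar x α m' j l = 0) ∧
          (quadMon x i l ∉ R → aPar x α i i j = aPar x α l j l)) ∧
        -- (II)
        ((i ≠ l →
            (∀ r, r ≠ i → r ≠ l → dPar x α r i j l = 0) ∧
            dPar x α l i j l = -bPar x β i j ∧
            dPar x α i i j l = bPar x β j l) ∧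
          (i = l →
            (∀ r, r ≠ i → dPar x α r i j l = 0) ∧
            dPar x α i i j l = bPar x β j i - bPar x β i j)) ∧
        -- (III)
        (∑ m with quadMon x m l ∈ R, aPar x α m i j * bPar x β m l) -
          (∑ m' with quadMon x i m' ∈ R, bPar x β i m' * aPar x α m' j l) = 0 := by
  -- The index set used is that of pairs whose monomial lies in `R`, not `S` itself. Thus
  -- independence of the monomials is never needed, and `Confluent` unfolds to the stated
  -- conditions.
  exact (spansRelators_deformedRel hR α β).isPBWDeformation_iff (spansRelators_relSpace hR)
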